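/- Consider an entanglement generation switch (EGS) with $C$ resources, connected to $K$ nodes, node $n_k$ having $c_k\ge 1$ communication qubits, and a finite set $\mathcal F$ of flows, each flow $f$ having two distinct nodes (we write $n_k\in f$). A session of flow $f$ is a finite sequence of attempt and calibration periods that begins and ends with an attempt; each period consists of finitely many phases with exponential durations. On completing a phase, a session moves to the next phase of the period, moves to the first phase of the next period, or (from attempt phases only) ends, with given probabilities. The state $\mathbf x$ records the number of sessions in each phase of each flow; let $q_f$ be the number of active sessions of flow $f$ and $\mathbf q=(q_f)_{f\in\mathcal F}$. The admissible states are those with $\sum_{f} q_f\le C$ and $\sum_{f: n_k\in f} q_f\le c_k$ for all $k$. Put $$\mathcal Q(h)=\Big\{\mathbf q:\ \sum_f q_f=h,\ \sum_{f:n_k\in f}q_f\le c_k\ \forall k\Big\},\qquad \mathcal Q'(f)=\Big\{\mathbf q:\ \sum_{g:n_k\in g}q_g\le c_k\ \forall n_k\notin f,\ \sum_{g:n_l\in g}q_g<c_l\ \forall n_l\in f\Big\}.$$ Flow $f$ generates requests at rate $\nu_1^f\ge 0$ (not all zero) while both of its nodes have a free qubit, and none otherwise. A request that finds fewer than $C$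 active sessions is accepted and starts a session in its first phase, holding one resource and one qubit of each of its two nodes until it ends; a request that finds all $C$ resources occupied is blocked and lost. The resulting continuous-time Markov chain is started in its stationary distribution, and $\mathrm P(A)$ denotes the stationary probability that $\mathbf q\in A$. Let $\overline\pi_f(C)$ be the probability that an arriving request of flow $f$ is blocked, and $\overline\pi(C)$ the probability that an arriving request (of any flow) is blocked, that is, the expected number of blocked requests during $(0,t]$ divided by the expected number of requests during $(0,t]$, of flow $f$ and of all flows, respectively. (If $\nu_1^f=0$ then $\overline\pi_f(C)$ is set to $0$.) Then, for every $t>0$, all these expected numbers are finite, the expected number of requests is positive in total and for each flow with $\nu_1^f>0$, $\mathrm P(\mathcal Q'(f))>0$ for all $f$, $\sum_{g}\mathrm P(\mathcal Q'(g))\nu_1^g>0$, $$\overline\pi_f(C)=\frac{\mathrm P(\mathcal Q(C)\cap\mathcal Q'(f))}{\mathrm P(\mathcal Q'(f))}\quad\text{for every } f \text{ with } \nu_1^f>0,$$ and $$\overline{\pi}(C)=\sum_{f\in\mathcal F}\left\{\frac{\mathrm P(\mathcal Q'(f))\,\nu_1^f}{\sum_{g\in\mathcal F}\mathrm P(\mathcal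 Q'(g))\,\nu_1^g}\right\}\overline\pi_f(C).$$ -/

import Mathlib

open MeasureTheory ProbabilityTheory Filter Topology
open scoped NNReal

/-- The structure of a session: a sequence of periods (entanglement generation attempts and
calibration periods), each decomposed into finitely many exponential phases (Coxian periods).
Phase `⟨j, i⟩` is the `i`-th phase of the `j`-th period. -/
structure SessionType where
  /-- number of periods -/
  numPeriods : ℕ
  numPeriods_pos : 0 < numPeriods
  /-- `true` for a calibration period, `false` for an attempt -/
  isCalibration : Fin numPeriods → Bool
  /-- number of exponential phases of each period -/
  numPhases : Fin numPeriods → ℕ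
  numPhases_pos : ∀ j, 0 < numPhases j
  /-- sessions begin and end with an attempt -/
  first_attempt : isCalibration ⟨0, numPeriods_pos⟩ = false
  last_attempt : isCalibration ⟨numPeriods - 1, Nat.sub_lt numPeriods_pos Nat.one_pos⟩ = false
  /-- processing rate of each phase -/
  rate : (Σ j : Fin numPeriods, Fin (numPhases j)) → ℝ
  rate_pos : ∀ φ, 0 < rate φ
  /-- probability of moving from one phase to another when the former is completed -/
  route : (Σ j : Fin numPeriods, Fin (numPhases j)) →
    (Σ j : Fin numPeriods, Fin (numPhases j)) → ℝ
  route_nonneg : ∀ φ ψ, 0 ≤ route φ ψ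
  /-- a session only moves to the next phase of the same period, or to the first phase of the
  next period -/
  route_support : ∀ φ ψ, route φ ψ ≠ 0 →
    (ψ.1 = φ.1 ∧ (ψ.2 : ℕ) = φ.2 + 1) ∨ ((ψ.1 : ℕ) = φ.1 + 1 ∧ (ψ.2 : ℕ) = 0)
  /-- probability that the session ends when a phase is completed -/
  leave : (Σ j : Fin numPeriods, Fin (numPhases j)) → ℝ
  leave_nonneg : ∀ φ, 0 ≤ leave φ
  /-- a session cannot end from a calibration phase -/
  leave_calibration : ∀ φ, isCalibration φ.1 = true → leave φ = 0
  route_add_leave : ∀ φ, ∑ ψ, route φ ψ + leave φ = 1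

namespace SessionType

/-- The phases of a session. -/
abbrev Phase (s : SessionType) : Type := Σ j : Fin s.numPeriods, Fin (s.numPhases j)

/-- The first phase of the first period. -/
def firstPhase (s : SessionType) : s.Phase := ⟨⟨0, s.numPeriods_pos⟩, ⟨0, s.numPhases_pos _⟩⟩

end SessionType

/-- Parameters of an entanglement generation switch (EGS) with `K` nodes and set of flows `F`. -/
structure EGS (F : Type*) (K : ℕ) where
  /-- number `C` of resources of the switch -/
  resources : ℕ
  /-- number `c_k` of communication qubits of node `k` -/
  qubits : Fin K → ℕ
  qubits_pos : ∀ k, 0 < qubits k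
  /-- the two (distinct) nodes of a flow -/
  nodes : F → Sym2 (Fin K)
  nodes_not_isDiag : ∀ f, ¬ (nodes f).IsDiag
  /-- the structure of the sessions of a flow -/
  session : F → SessionType
  /-- rate `ν₁` of the Poisson request stream of a flow -/
  arrivalRate : F → ℝ
  arrivalRate_nonneg : ∀ f, 0 ≤ arrivalRate f
  exists_arrivalRate_pos : ∃ f, 0 < arrivalRate f

noncomputable section

namespace EGS

variable {F : Type*} [Fintype F] [DecidableEq F] {K : ℕ} (N : EGS F K)

/-- A state records the number of jobs in every phase of every flow. -/
abbrev State {F : Type*} {K : ℕ} (N : EGS F K) : Type _ := (f : F) → (N.session f).Phase → ℕ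

/-- Number of active sessions of each flow. -/
def sessions (x : N.State) (f : F) : ℕ := ∑ φ, x f φ

open Classical in
/-- Number of occupied qubits of node `k` if `q f` sessions of each flow `f` are active. -/
def usedQubits (q : F → ℕ) (k : Fin K) : ℕ := ∑ f with k ∈ N.nodes f, q f

/-- The admissible states, as a set. -/
def admissible : Set N.State :=
  {x | ∑ f, N.sessions x f ≤ N.resources ∧ ∀ k, N.usedQubits (N.sessions x) k ≤ N.qubits k}

theorem finite_admissible : N.admissible.Finite := by
  refine (Set.finite_Iic (fun _ _ => N.resources : N.State)).subset fun x hx f φ => ?_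
  have h1 : x f φ ≤ N.sessions x f :=
    Finset.single_le_sum (f := fun φ => x f φ) (fun _ _ => Nat.zero_le _) (Finset.mem_univ φ)
  have h2 : N.sessions x f ≤ ∑ f, N.sessions x f :=
    Finset.single_le_sum (f := fun f => N.sessions x f) (fun _ _ => Nat.zero_le _)
      (Finset.mem_univ f)
  exact h1.trans (h2.trans hx.1)

/-- The state space `𝒮`: at most `C` sessions are active in total, and at most `c_k` sessions
involve node `k`. -/
def stateSpace : Finset N.State := N.finite_admissible.toFinset

/-- `𝒬(h)`: the session counts with exactly `h` active sessions that respect the qubit limits. -/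
def countsWithTotal (h : ℕ) : Set (F → ℕ) :=
  {q | ∑ f, q f = h ∧ ∀ k, N.usedQubits q k ≤ N.qubits k}

/-- `𝒬'(f)`: the session counts that respect the qubit limits and for which both nodes of flow `f`
have a free qubit. -/
def countsWithFreeQubits (f : F) : Set (F → ℕ) :=
  {q | (∀ k, k ∉ N.nodes f → N.usedQubits q k ≤ N.qubits k) ∧
    ∀ k, k ∈ N.nodes f → N.usedQubits q k < N.qubits k}

/-- The state with a single job, in phase `φ` of flow `f`. -/
def unit (f : F) (φ : (N.session f).Phase) : N.State := Pi.single f (Pi.single φ 1)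

/-- A configuration: the current state, the number of requests so far and the number of blocked
requests so far, the latter two by flow. -/
abbrev Config {F : Type*} {K : ℕ} (N : EGS F K) : Type _ := N.State × (F → ℕ) × (F → ℕ)

open Classical in
/-- Rate at which flow `f` generates requests in state `x`: requests are generated only if both
nodes of the flow have a free qubit. -/
def requestRate (x : N.State) (f : F) : ℝ :=
  if ∀ k ∈ N.nodes f, N.usedQubits (N.sessions x) k < N.qubits k then N.arrivalRate f else 0

/-- Effect of a request of flow `f`. If a resource is free then the request is accepted and a
session starts in its first phase; if all resources are occupied then the request is blocked. -/
def afterRequest (f : F) : N.Config → N.Config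
  | (x, r, b) =>
    if ∑ g, N.sessions x g < N.resources then
      (x + N.unit f (N.session f).firstPhase, r + Pi.single f 1, b)
    else (x, r + Pi.single f 1, b + Pi.single f 1)

/-- The generator of the Markov chain of configurations: requests arrive at rate `requestRate`, and
each of the `x f φ` jobs in phase `φ` of flow `f` is completed at the rate of that phase, upon which
the session moves to another phase or ends. -/
def generator (h : N.Config → ℝ) : N.Config → ℝ
  | (x, r, b) =>
    ∑ f, N.requestRate x f * (h (N.afterRequest f (x, r, b)) - h (x, r, b)) +
    ∑ f, ∑ φ, (x f φ : ℝ) * (N.session f).rate φ *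
      (∑ ψ, (N.session f).route φ ψ * (h (x - N.unit f φ + N.unit f ψ, r, b) - h (x, r, b)) +
        (N.session f).leave φ * (h (x - N.unit f φ, r, b) - h (x, r, b)))

/-- `p` is a stationary distribution of the state process: a probability vector on the state space
with `p A = 0` (global balance, tested on functions), where `A` is the generator of the state
process, that is, `generator` on functions of the state alone. -/
structure IsStationary (p : N.State → ℝ) : Prop where
  nonneg : ∀ x, 0 ≤ p x
  zero_off : ∀ x, x ∉ N.stateSpace → p x = 0
  sum_eq_one : ∑ x ∈ N.stateSpace, p x = 1
  balance : ∀ h : N.State → ℝ,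
    ∑ x ∈ N.stateSpace, p x * N.generator (fun z => h z.1) (x, 0, 0) = 0

open Classical in
/-- Probability, under the distribution `p` of the state, that the vector of the numbers of active
sessions lies in `A`. -/
def prob (p : N.State → ℝ) (A : Set (F → ℕ)) : ℝ :=
  ∑ x ∈ N.stateSpace with N.sessions x ∈ A, p x

/-- `Z` is a realization of the EGS started in the distribution `p`: a right-continuous
jump process with values in the configurations over the state space, whose state is distributed
as `p` at time `0`, whose counters start at `0`, and which is the Markov chain with the above
generator, in the sense that it solves the martingale problem of the generator. -/
structure IsRealization (p : N.State → ℝ) {Ω : Type*} {mΩ : MeasurableSpace Ω} (P : Measure Ω)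
    (ℱ : Filtration ℝ≥0 mΩ) (Z : ℝ≥0 → Ω → N.Config) : Prop where
  adapted : ∀ t, Measurable[ℱ t] (Z t)
  rightContinuous : ∀ ω t, ∀ᶠ s in 𝓝[>] t, Z s ω = Z t ω
  mem_stateSpace : ∀ t ω, (Z t ω).1 ∈ N.stateSpace
  init_state : ∀ x, P.real {ω | (Z 0 ω).1 = x} = p x
  init_counts : ∀ ω, (Z 0 ω).2 = 0
  martingale : ∀ h : N.Config → ℝ, (∃ c, ∀ z, |h z| ≤ c) →
    Martingale (fun t ω => h (Z t ω) - ∫ s in (0 : ℝ)..t, N.generator h (Z s.toNNReal ω)) ℱ P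

/-- Number of requests of flow `f` up to time `t`. -/
def requests {N : EGS F K} {Ω : Type*} (Z : ℝ≥0 → Ω → N.Config) (f : F) (t : ℝ≥0) (ω : Ω) : ℝ :=
  (Z t ω).2.1 f

/-- Number of blocked requests of flow `f` up to time `t`. -/
def blocked {N : EGS F K} {Ω : Type*} (Z : ℝ≥0 → Ω → N.Config) (f : F) (t : ℝ≥0) (ω : Ω) : ℝ :=
  (Z t ω).2.2 f

/-- Probability that an arriving request of flow `f` is blocked (in steady state: the Palm
probability, the expected number of blocked requests of `f` during `(0, t]` over the expected number
of requests of `f` during `(0, t]`). -/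
def flowBlockingProb {N : EGS F K} {Ω : Type*} [MeasurableSpace Ω] (P : Measure Ω)
    (Z : ℝ≥0 → Ω → N.Config) (t : ℝ≥0) (f : F) : ℝ :=
  (∫ ω, blocked Z f t ω ∂P) / ∫ ω, requests Z f t ω ∂P

/-- Average blocking probability: the probability that an arriving request, of whichever flow, is
blocked (again the ratio of the expected numbers during `(0, t]`, now of all requests). -/
def avgBlockingProb {N : EGS F K} {Ω : Type*} [MeasurableSpace Ω] (P : Measure Ω)
    (Z : ℝ≥0 → Ω → N.Config) (t : ℝ≥0) : ℝ :=
  (∫ ω, ∑ f, blocked Z f t ω ∂P) / ∫ ω, ∑ f, requests Z f t ω ∂P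

end EGS

end

/-! The number of requests of a flow and the number of its blocked requests are counters whose
intensities are functions of the state alone. On the state space the first intensity is `arrivalRate
f` where both nodes have a free qubit and zero elsewhere. The second is its restriction to states
with all resources occupied. In the stationary regime the mean of such a counter at time `t` is `t`
times the stationary mean of its intensity, so `t` and `arrivalRate f` cancel in the ratio for each
flow. The average over flows is then algebra.

Three facts carry this. The law of the state stays equal to `p` (`real_state_eq`): Dynkin's formula
gives a finite linear system for the state probabilities, and `p` is an equilibrium of it. Counters
are unbounded while the martingale property concerns bounded functions, so their means are computed
by truncation and passage to the limit (`integrable_and_integral_counter`). Finally, the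
denominators are positive because the empty state has positive mass (`zero_pos`): sessions only move
forward through their phases, so every state can drain. -/

set_option linter.unusedSectionVars false

/-! ### Progress of a session through its phases -/

namespace SessionType

/-- An upper bound on the number of phases that a session in phase `φ` still has to complete,
weighted so that it decreases along every admissible transition. -/
def remaining (s : SessionType) (φ : s.Phase) : ℕ :=
  (∑ i, s.numPhases i) * (s.numPeriods - φ.1) - φ.2

theorem numPhases_le_sum (s : SessionType) (j : Fin s.numPeriods) :
    s.numPhases j ≤ ∑ i, s.numPhases i :=
  Finset.single_le_sum (f := s.numPhases) (fun _ _ => Nat.zero_le _) (Finset.mem_univ j)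

/-- At least one period is left, and the total number of phases exceeds any index within a period.
Hence the subtraction in `remaining` never truncates. -/
theorem phase_lt_mul (s : SessionType) (φ : s.Phase) :
    (φ.2 : ℕ) < (∑ i, s.numPhases i) * (s.numPeriods - φ.1) := by
  have h1 := s.numPhases_le_sum φ.1
  have h2 := φ.2.2
  have h3 := φ.1.2
  have h4 : (∑ i, s.numPhases i) * 1 ≤ (∑ i, s.numPhases i) * (s.numPeriods - φ.1) :=
    Nat.mul_le_mul_left _ (by omega)
  omega

theorem remaining_pos (s : SessionType) (φ : s.Phase) : 0 < s.remaining φ :=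
  Nat.sub_pos_of_lt (s.phase_lt_mul φ)

/-- Within a period the subtracted index grows by one. Entering the next period resets that index
but costs the total number of phases, which is more than the reset gives back. -/
theorem remaining_lt_of_route_ne_zero (s : SessionType) {φ ψ : s.Phase} (h : s.route φ ψ ≠ 0) :
    s.remaining ψ < s.remaining φ := by
  have hφ := s.phase_lt_mul φ
  unfold remaining
  rcases s.route_support φ ψ h with ⟨h1, h2⟩ | ⟨h1, h2⟩
  · have h3 : (ψ.1 : ℕ) = φ.1 := congrArg Fin.val h1
    rw [h2, h3]; omega
  · have h3 := ψ.1.2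
    have h4 := φ.2.2
    have h5 := s.numPhases_le_sum φ.1
    have h6 : s.numPeriods - (φ.1 : ℕ) = (s.numPeriods - ψ.1) + 1 := by omega
    rw [h6, mul_add]
    omega

theorem leave_pos_or_exists_route_pos (s : SessionType) (φ : s.Phase) :
    0 < s.leave φ ∨ ∃ ψ, 0 < s.route φ ψ := by
  by_contra! h
  have h1 : ∑ ψ, s.route φ ψ ≤ 0 := Finset.sum_nonpos fun ψ _ => h.2 ψ
  linarith [s.route_add_leave φ, h.1]

end SessionType

/-! ### Draining of the switch and positivity of the empty state -/

namespace EGS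

variable {F : Type*} [Fintype F] [DecidableEq F] {K : ℕ} (N : EGS F K)

/-- Weighted amount of work left in a state. -/
def workload (x : N.State) : ℕ := ∑ f, ∑ φ, x f φ * (N.session f).remaining φ

theorem mem_stateSpace {x : N.State} :
    x ∈ N.stateSpace ↔
      ∑ f, N.sessions x f ≤ N.resources ∧ ∀ k, N.usedQubits (N.sessions x) k ≤ N.qubits k := by
  rw [stateSpace, Set.Finite.mem_toFinset]; rfl

theorem sessions_add (x y : N.State) : N.sessions (x + y) = N.sessions x + N.sessions y := by
  funext f; simp [sessions, Finset.sum_add_distrib]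

theorem mem_stateSpace_of_sessions_le {x y : N.State} (h : N.sessions y ≤ N.sessions x)
    (hx : x ∈ N.stateSpace) : y ∈ N.stateSpace := by
  rw [mem_stateSpace] at hx ⊢
  exact ⟨(Finset.sum_le_sum fun f _ => h f).trans hx.1,
    fun k => (Finset.sum_le_sum fun f _ => h f).trans (hx.2 k)⟩

theorem workload_add (x y : N.State) : N.workload (x + y) = N.workload x + N.workload y := by
  simp [workload, add_mul, Finset.sum_add_distrib]

theorem sessions_unit (f : F) (φ : (N.session f).Phase) :
    N.sessions (N.unit f φ) = Pi.single f 1 := by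
  funext g
  rcases eq_or_ne g f with rfl | hg
  · simp [sessions, unit]
  · simp [sessions, unit, Pi.single_eq_of_ne hg]

theorem workload_unit (f : F) (φ : (N.session f).Phase) :
    N.workload (N.unit f φ) = (N.session f).remaining φ := by
  rw [workload, Finset.sum_eq_single f _ (by simp)]
  · simp [unit, Pi.single_apply]
  · intro g _ hg
    simp [unit, Pi.single_eq_of_ne hg]

theorem sub_unit_add_unit {x : N.State} {f : F} {φ : (N.session f).Phase} (h : x f φ ≠ 0) :
    x - N.unit f φ + N.unit f φ = x := by
  funext g ψ
  simp only [Pi.add_apply, Pi.sub_apply]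
  refine Nat.sub_add_cancel ?_
  rcases eq_or_ne g f with rfl | hg
  · rcases eq_or_ne ψ φ with rfl | hψ
    · simpa [unit] using Nat.one_le_iff_ne_zero.2 h
    · simp [unit, Pi.single_eq_of_ne hψ]
  · simp [unit, Pi.single_eq_of_ne hg]

theorem requestRate_nonneg (x : N.State) (f : F) : 0 ≤ N.requestRate x f := by
  unfold requestRate
  split_ifs
  exacts [N.arrivalRate_nonneg f, le_rfl]

theorem requestRate_le (x : N.State) (f : F) : N.requestRate x f ≤ N.arrivalRate f := by
  unfold requestRate
  split_ifs
  exacts [le_rfl, N.arrivalRate_nonneg f]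

/-- At a minimum of `h`, all terms of the generator are nonnegative. -/
theorem completion_term_nonneg {h : N.State → ℝ} {x : N.State} (hx : ∀ y, h x ≤ h y) (f : F)
    (φ : (N.session f).Phase) :
    0 ≤ (x f φ : ℝ) * (N.session f).rate φ *
      (∑ ψ, (N.session f).route φ ψ * (h (x - N.unit f φ + N.unit f ψ) - h x) +
        (N.session f).leave φ * (h (x - N.unit f φ) - h x)) :=
  mul_nonneg (mul_nonneg (Nat.cast_nonneg _) ((N.session f).rate_pos φ).le)
    (add_nonneg (Finset.sum_nonneg fun ψ _ =>
      mul_nonneg ((N.session f).route_nonneg φ ψ) (sub_nonneg.2 (hx _)))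
      (mul_nonneg ((N.session f).leave_nonneg φ) (sub_nonneg.2 (hx _))))

theorem request_term_nonneg {h : N.State → ℝ} {x : N.State} (hx : ∀ y, h x ≤ h y) (f : F) :
    0 ≤ N.requestRate x f * (h (N.afterRequest f (x, 0, 0)).1 - h x) :=
  mul_nonneg (N.requestRate_nonneg x f) (sub_nonneg.2 (hx _))

theorem generator_nonneg_of_isMin {h : N.State → ℝ} {x : N.State} (hx : ∀ y, h x ≤ h y) :
    0 ≤ N.generator (fun z => h z.1) (x, 0, 0) :=
  add_nonneg (Finset.sum_nonneg fun f _ => N.request_term_nonneg hx f)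
    (Finset.sum_nonneg fun f _ => Finset.sum_nonneg fun φ _ => N.completion_term_nonneg hx f φ)

/-- All other terms are nonnegative at a minimum, so one positive term suffices to make the
generator positive. -/
theorem completion_term_le_generator {h : N.State → ℝ} {x : N.State} (hx : ∀ y, h x ≤ h y) (f : F)
    (φ : (N.session f).Phase) :
    (x f φ : ℝ) * (N.session f).rate φ *
      (∑ ψ, (N.session f).route φ ψ * (h (x - N.unit f φ + N.unit f ψ) - h x) +
        (N.session f).leave φ * (h (x - N.unit f φ) - h x)) ≤
      N.generator (fun z => h z.1) (x, 0, 0) := by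
  refine le_trans ?_ (le_add_of_nonneg_left
    (Finset.sum_nonneg fun f _ => N.request_term_nonneg hx f))
  refine le_trans ?_ (Finset.single_le_sum
    (f := fun f => ∑ φ, (x f φ : ℝ) * (N.session f).rate φ *
      (∑ ψ, (N.session f).route φ ψ * (h (x - N.unit f φ + N.unit f ψ) - h x) +
        (N.session f).leave φ * (h (x - N.unit f φ) - h x)))
    (fun f _ => Finset.sum_nonneg fun φ _ => N.completion_term_nonneg hx f φ) (Finset.mem_univ f))
  exact Finset.single_le_sum
    (f := fun φ => (x f φ : ℝ) * (N.session f).rate φ *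
      (∑ ψ, (N.session f).route φ ψ * (h (x - N.unit f φ + N.unit f ψ) - h x) +
        (N.session f).leave φ * (h (x - N.unit f φ) - h x)))
    (fun φ _ => N.completion_term_nonneg hx f φ) (Finset.mem_univ φ)

/-- From every nonzero state, the chain can jump to a state with less work left. -/
theorem exists_workload_lt_generator_pos {x : N.State} (hx : x ∈ N.stateSpace) (h0 : x ≠ 0) :
    ∃ y ∈ N.stateSpace, N.workload y < N.workload x ∧
      0 < N.generator (fun z => (Pi.single y 1 : N.State → ℝ) z.1) (x, 0, 0) := by
  obtain ⟨f, φ, hφ⟩ : ∃ f φ, x f φ ≠ 0 := by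
    by_contra! h
    exact h0 (funext fun f => funext fun φ => h f φ)
  have hsub := N.sub_unit_add_unit hφ
  have hs : N.sessions (x - N.unit f φ) + Pi.single f 1 = N.sessions x := by
    rw [← N.sessions_unit f φ, ← sessions_add, hsub]
  have hw : N.workload (x - N.unit f φ) + (N.session f).remaining φ = N.workload x := by
    rw [← N.workload_unit f φ, ← workload_add, hsub]
  have hcoef : 0 < (x f φ : ℝ) * (N.session f).rate φ :=
    mul_pos (by exact_mod_cast Nat.pos_of_ne_zero hφ) ((N.session f).rate_pos φ)
  -- The indicator of `y` is minimal at every `x ≠ y`, and its generator there is the jump rate from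
  -- `x` to `y`.
  have hmin : ∀ y, y ≠ x → ∀ z, (Pi.single y 1 : N.State → ℝ) x ≤ (Pi.single y 1 : N.State → ℝ) z := by
    intro y hy z
    rw [Pi.single_eq_of_ne hy.symm]
    by_cases hz : z = y
    · subst hz; simp
    · simp [Pi.single_eq_of_ne hz]
  rcases (N.session f).leave_pos_or_exists_route_pos φ with hl | ⟨ψ, hψ⟩
  · have hlt : N.workload (x - N.unit f φ) < N.workload x := by
      have := (N.session f).remaining_pos φ
      omega
    have hne : x - N.unit f φ ≠ x := fun h => by rw [h] at hlt; exact lt_irrefl _ hlt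
    refine ⟨x - N.unit f φ, N.mem_stateSpace_of_sessions_le ?_ hx, hlt,
      lt_of_lt_of_le ?_ (N.completion_term_le_generator (hmin _ hne) f φ)⟩
    · rw [← hs]; exact le_self_add
    · refine mul_pos hcoef (add_pos_of_nonneg_of_pos (Finset.sum_nonneg fun ψ _ =>
        mul_nonneg ((N.session f).route_nonneg φ ψ) (sub_nonneg.2 (hmin _ hne _))) ?_)
      simpa [Pi.single_eq_of_ne hne.symm] using hl
  · have hlt : N.workload (x - N.unit f φ + N.unit f ψ) < N.workload x := by
      have := (N.session f).remaining_lt_of_route_ne_zero hψ.ne'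
      rw [workload_add, workload_unit]
      omega
    have hne : x - N.unit f φ + N.unit f ψ ≠ x :=
      fun h => by rw [h] at hlt; exact lt_irrefl _ hlt
    refine ⟨x - N.unit f φ + N.unit f ψ, N.mem_stateSpace_of_sessions_le ?_ hx, hlt,
      lt_of_lt_of_le ?_ (N.completion_term_le_generator (hmin _ hne) f φ)⟩
    · rw [sessions_add, sessions_unit, hs]
    · refine mul_pos hcoef (add_pos_of_pos_of_nonneg ?_
        (mul_nonneg ((N.session f).leave_nonneg φ) (sub_nonneg.2 (hmin _ hne _))))
      refine Finset.sum_pos' (fun ψ _ =>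
        mul_nonneg ((N.session f).route_nonneg φ ψ) (sub_nonneg.2 (hmin _ hne _)))
        ⟨ψ, Finset.mem_univ _, ?_⟩
      simpa [Pi.single_eq_of_ne hne.symm] using hψ

theorem zero_mem_stateSpace : (0 : N.State) ∈ N.stateSpace := by
  simp [mem_stateSpace, sessions, usedQubits]

namespace IsStationary

variable {N} {p : N.State → ℝ}

/-- A stationary distribution vanishes at every state from which one can jump to a null state. -/
theorem eq_zero_of_generator_pos (hp : N.IsStationary p) {x y : N.State} (hx : x ∈ N.stateSpace)
    (hy : p y = 0)
    (hxy : 0 < N.generator (fun z => (Pi.single y 1 : N.State → ℝ) z.1) (x, 0, 0)) : p x = 0 := by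
  -- Balance tested on the indicator of `y` says that the net flow into `y` is zero. The only term
  -- that could be negative is the outflow from `y`, which vanishes with `p y`, so every inflow
  -- vanishes too.
  have h := hp.balance (Pi.single y 1)
  rw [Finset.sum_eq_zero_iff_of_nonneg] at h
  · exact (mul_eq_zero.1 (h x hx)).resolve_right hxy.ne'
  · intro w _
    rcases eq_or_ne w y with rfl | hw
    · simp [hy]
    · refine mul_nonneg (hp.nonneg w) (N.generator_nonneg_of_isMin fun z => ?_)
      rw [Pi.single_eq_of_ne hw]
      by_cases hz : z = y
      · subst hz; simp
      · simp [Pi.single_eq_of_ne hz]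

/-- If the empty state were null, induction on the workload would make every state null, since each
nonempty state can jump to one with less work. This contradicts total mass one. -/
theorem zero_pos (hp : N.IsStationary p) : 0 < p 0 := by
  refine lt_of_le_of_ne (hp.nonneg 0) fun h0 => ?_
  have key : ∀ n, ∀ x ∈ N.stateSpace, N.workload x = n → p x = 0 := by
    intro n
    induction n using Nat.strong_induction_on with
    | _ n ih =>
      intro x hx hn
      rcases eq_or_ne x 0 with rfl | hne
      · exact h0.symm
      · obtain ⟨y, hy, hlt, hpos⟩ := N.exists_workload_lt_generator_pos hx hne
        exact hp.eq_zero_of_generator_pos hx (ih _ (hn ▸ hlt) y hy rfl) hpos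
  have h1 := hp.sum_eq_one
  rw [Finset.sum_eq_zero fun x hx => key _ x hx rfl] at h1
  exact zero_ne_one h1

theorem prob_countsWithFreeQubits_pos (hp : N.IsStationary p) (f : F) :
    0 < N.prob p (N.countsWithFreeQubits f) := by
  classical
  refine Finset.sum_pos' (fun x _ => hp.nonneg x) ⟨0, ?_, hp.zero_pos⟩
  rw [Finset.mem_filter]
  refine ⟨N.zero_mem_stateSpace, ?_⟩
  simp [countsWithFreeQubits, sessions, usedQubits, N.qubits_pos]

end IsStationary

/-! ### Intensities of the request and blocking counters -/

theorem sessions_mem_countsWithFreeQubits {x : N.State} (hx : x ∈ N.stateSpace) (f : F) :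
    N.sessions x ∈ N.countsWithFreeQubits f ↔
      ∀ k ∈ N.nodes f, N.usedQubits (N.sessions x) k < N.qubits k :=
  ⟨fun h => h.2, fun h => ⟨fun k _ => (N.mem_stateSpace.1 hx).2 k, h⟩⟩

theorem sum_mul_requestRate (p : N.State → ℝ) (f : F) :
    ∑ x ∈ N.stateSpace, p x * N.requestRate x f =
      N.prob p (N.countsWithFreeQubits f) * N.arrivalRate f := by
  classical
  rw [prob, Finset.sum_filter, Finset.sum_mul]
  refine Finset.sum_congr rfl fun x hx => ?_
  simp only [requestRate, N.sessions_mem_countsWithFreeQubits hx]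
  split_ifs <;> simp

/-- Rate at which flow `f` generates blocked requests in state `x`. -/
noncomputable def blockedRate (x : N.State) (f : F) : ℝ :=
  if ∑ g, N.sessions x g < N.resources then 0 else N.requestRate x f

theorem sum_mul_blockedRate (p : N.State → ℝ) (f : F) :
    ∑ x ∈ N.stateSpace, p x * N.blockedRate x f =
      N.prob p (N.countsWithTotal N.resources ∩ N.countsWithFreeQubits f) * N.arrivalRate f := by
  classical
  rw [prob, Finset.sum_filter, Finset.sum_mul]
  refine Finset.sum_congr rfl fun x hx => ?_
  have hx' := N.mem_stateSpace.1 hx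
  -- An admissible state never exceeds the capacity, so "not below capacity" means "exactly at
  -- capacity".
  have h1 : N.sessions x ∈ N.countsWithTotal N.resources ↔
      ¬ ∑ g, N.sessions x g < N.resources :=
    ⟨fun h => h.1.not_lt, fun h => ⟨le_antisymm hx'.1 (not_lt.1 h), hx'.2⟩⟩
  simp only [blockedRate, requestRate, Set.mem_inter_iff, N.sessions_mem_countsWithFreeQubits hx,
    h1]
  split_ifs <;> simp_all

theorem blockedRate_nonneg (x : N.State) (f : F) : 0 ≤ N.blockedRate x f := by
  unfold blockedRate
  split_ifs
  exacts [le_rfl, N.requestRate_nonneg x f]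

theorem blockedRate_le (x : N.State) (f : F) : N.blockedRate x f ≤ N.arrivalRate f := by
  unfold blockedRate
  split_ifs
  exacts [N.arrivalRate_nonneg f, N.requestRate_le x f]

/-- The counters do not influence the dynamics of the state. -/
theorem generator_comp_fst (h : N.State → ℝ) (z : N.Config) :
    N.generator (fun z => h z.1) z = N.generator (fun z => h z.1) (z.1, 0, 0) := by
  obtain ⟨x, r, b⟩ := z
  simp only [generator, afterRequest, apply_ite Prod.fst]

theorem min_add_one_sub_min (a n : ℕ) :
    min ((a + 1 : ℕ) : ℝ) n - min (a : ℝ) n = if a < n then 1 else 0 := by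
  split_ifs with h
  · rw [min_eq_left (by exact_mod_cast h), min_eq_left (by exact_mod_cast h.le)]
    push_cast; ring
  · rw [min_eq_right (by exact_mod_cast (by omega)), min_eq_right (by exact_mod_cast not_lt.1 h),
      sub_self]

/-- Truncation at `n` makes the counter a bounded test function. It keeps its intensity until it
reaches `n`, and completions of phases do not touch it. -/
theorem generator_min_requests (f : F) (n : ℕ) (z : N.Config) :
    N.generator (fun z => min (z.2.1 f : ℝ) n) z =
      N.requestRate z.1 f * if z.2.1 f < n then 1 else 0 := by
  obtain ⟨x, r, b⟩ := z
  have h2 : ∀ g, (N.afterRequest g (x, r, b)).2.1 = r + Pi.single g 1 := by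
    intro g; simp only [afterRequest]; split_ifs <;> rfl
  simp only [generator, h2, sub_self, mul_zero, Finset.sum_const_zero, add_zero]
  rw [Finset.sum_eq_single f _ (by simp)]
  · rw [← min_add_one_sub_min]; simp
  · intro g _ hg
    simp [Pi.single_eq_of_ne hg.symm]

theorem generator_min_blocked (f : F) (n : ℕ) (z : N.Config) :
    N.generator (fun z => min (z.2.2 f : ℝ) n) z =
      N.blockedRate z.1 f * if z.2.2 f < n then 1 else 0 := by
  obtain ⟨x, r, b⟩ := z
  have h2 : ∀ g, (N.afterRequest g (x, r, b)).2.2 =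
      if ∑ g, N.sessions x g < N.resources then b else b + Pi.single g 1 := by
    intro g; simp only [afterRequest]; split_ifs <;> rfl
  simp only [generator, h2, sub_self, mul_zero, Finset.sum_const_zero, add_zero]
  rw [Finset.sum_eq_single f _ (by simp)]
  · rw [← min_add_one_sub_min, blockedRate]
    split_ifs <;> simp
  · intro g _ hg
    split_ifs <;> simp [Pi.single_eq_of_ne hg.symm]

end EGS

/-! ### Joint measurability of paths and uniqueness for linear systems -/

/-- A right-continuous jump process is jointly measurable. -/
theorem measurable_uncurry_of_eventually_eq_right {Ω E : Type*} [MeasurableSpace Ω]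
    [MeasurableSpace E] {Z : ℝ≥0 → Ω → E} (hm : ∀ t, Measurable (Z t))
    (hr : ∀ ω t, ∀ᶠ s in 𝓝[>] t, Z s ω = Z t ω) {g : E → ℝ} (hg : Measurable g) :
    Measurable fun q : ℝ≥0 × Ω => g (Z q.1 q.2) := by
  -- The first point of the grid of mesh `1 / (n + 1)` strictly to the right of `s`. Strictness lets
  -- right-continuity apply, and countability of the grid gives measurability of the approximations.
  let a : ℕ → ℝ≥0 → ℝ≥0 := fun n s => ((⌊s * (n + 1)⌋₊ : ℝ≥0) + 1) / (n + 1)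
  have hlt : ∀ n s, s < a n s := fun n s => by
    rw [lt_div_iff₀ (by positivity)]
    exact Nat.lt_floor_add_one _
  have hle : ∀ n s, a n s ≤ s + 1 / ((n : ℝ≥0) + 1) := fun n s => by
    rw [div_le_iff₀ (by positivity), add_mul, one_div_mul_cancel (by positivity)]
    gcongr
    exact Nat.floor_le zero_le
  have htend : ∀ s, Tendsto (fun n => a n s) atTop (𝓝[>] s) := fun s => by
    refine tendsto_nhdsWithin_iff.2 ⟨?_, Eventually.of_forall fun n => hlt n s⟩
    refine tendsto_of_tendsto_of_tendsto_of_le_of_le tendsto_const_nhds ?_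
      (fun n => (hlt n s).le) (fun n => hle n s)
    simpa using (tendsto_const_nhds (x := s)).add
      (tendsto_one_div_add_atTop_nhds_zero_nat (𝕜 := ℝ≥0))
  refine measurable_of_tendsto_metrizable (f := fun (n : ℕ) (q : ℝ≥0 × Ω) => g (Z (a n q.1) q.2))
    (fun n => ?_) (tendsto_pi_nhds.2 fun q => ?_)
  · have h1 : Measurable fun q : ℕ × Ω => g (Z (((q.1 : ℝ≥0) + 1) / (n + 1)) q.2) :=
      measurable_from_prod_countable_right fun k =>
        hg.comp (hm (((k : ℝ≥0) + 1) / (n + 1)))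
    have h2 : Measurable fun q : ℝ≥0 × Ω => (⌊q.1 * ((n : ℝ≥0) + 1)⌋₊, q.2) :=
      (Nat.measurable_floor.comp (measurable_fst.mul_const _)).prodMk measurable_snd
    simpa only [Function.comp_def] using h1.comp h2
  · exact tendsto_nhds_of_eventually_eq
      (((htend q.1).eventually (hr q.2 q.1)).mono fun n hn => congrArg g hn)

/-- A linear differential equation, in integrated form, has at most one solution on `[0, ∞)`: if the
initial value is an equilibrium then the solution is constant. -/
theorem eq_const_of_integral_eq_linear {E : Type*} [NormedAddCommGroup E] [NormedSpace ℝ E]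
    [CompleteSpace E] (L : E →L[ℝ] E) {u : ℝ → E} (hc : Continuous u)
    (hu : ∀ t, 0 ≤ t → u t = u 0 + ∫ s in (0 : ℝ)..t, L (u s)) (h0 : L (u 0) = 0) {t : ℝ}
    (ht : 0 ≤ t) : u t = u 0 := by
  have hLc : Continuous fun s => L (u s) := L.continuous.comp hc
  -- Only right derivatives are available at zero, as the integral equation holds for nonnegative
  -- times only.
  have hd : ∀ t, 0 ≤ t → HasDerivWithinAt u (L (u t)) (Set.Ici t) t := fun t ht => by
    have h1 : HasDerivAt (fun t => u 0 + ∫ s in (0 : ℝ)..t, L (u s)) (L (u t)) t :=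
      (intervalIntegral.integral_hasDerivAt_right (hLc.intervalIntegrable _ _)
        (hLc.stronglyMeasurableAtFilter _ _) hLc.continuousAt).const_add _
    exact h1.hasDerivWithinAt.congr (fun s hs => hu s (ht.trans hs)) (hu t ht)
  refine ODE_solution_unique (v := fun _ => L) (K := ‖L‖₊) (fun _ => L.lipschitz) hc.continuousOn
    (fun s hs => hd s hs.1) continuousOn_const (fun s _ => ?_) rfl (Set.right_mem_Icc.2 ht)
  simp only [h0]
  exact hasDerivWithinAt_const _ _ _

/-! ### Dynkin's formula, stationarity of the state, means of counters -/

namespace EGS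

variable {F : Type*} [Fintype F] [DecidableEq F] {K : ℕ} {N : EGS F K}

namespace IsRealization

variable {p : N.State → ℝ} {Ω : Type*} {mΩ : MeasurableSpace Ω} {P : Measure Ω}
  {ℱ : Filtration ℝ≥0 mΩ} {Z : ℝ≥0 → Ω → N.Config}

theorem measurable_comp (hZ : N.IsRealization p P ℱ Z) (h : N.Config → ℝ) (t : ℝ≥0) :
    Measurable fun ω => h (Z t ω) :=
  (measurable_of_countable h).comp ((hZ.adapted t).mono (ℱ.le t) le_rfl)

theorem measurable_comp_uncurry (hZ : N.IsRealization p P ℱ Z) (h : N.Config → ℝ) :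
    Measurable fun q : ℝ × Ω => h (Z q.1.toNNReal q.2) :=
  (measurable_uncurry_of_eventually_eq_right (fun t => (hZ.adapted t).mono (ℱ.le t) le_rfl)
    hZ.rightContinuous (measurable_of_countable h)).comp
    ((measurable_real_toNNReal.comp measurable_fst).prodMk measurable_snd)

variable [IsProbabilityMeasure P]

theorem integrable_comp (hZ : N.IsRealization p P ℱ Z) {h : N.Config → ℝ} {M : ℝ} (t : ℝ≥0)
    (hM : ∀ ω, |h (Z t ω)| ≤ M) : Integrable (fun ω => h (Z t ω)) P :=
  Integrable.of_bound (hZ.measurable_comp h t).aestronglyMeasurable M (Eventually.of_forall hM)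

theorem abs_integral_comp_le (h : N.Config → ℝ) {M : ℝ} (t : ℝ≥0)
    (hM : ∀ ω, |h (Z t ω)| ≤ M) : |∫ ω, h (Z t ω) ∂P| ≤ M := by
  simpa using norm_integral_le_of_norm_le_const (μ := P)
    (f := fun ω => h (Z t ω)) (Eventually.of_forall hM)

theorem stronglyMeasurable_integral_comp (hZ : N.IsRealization p P ℱ Z) (h : N.Config → ℝ) :
    StronglyMeasurable fun s : ℝ => ∫ ω, h (Z s.toNNReal ω) ∂P :=
  (hZ.measurable_comp_uncurry h).stronglyMeasurable.integral_prod_right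

theorem intervalIntegrable_integral_comp (hZ : N.IsRealization p P ℱ Z) {h : N.Config → ℝ} {M : ℝ}
    (hM : ∀ t ω, |h (Z t ω)| ≤ M) (a b : ℝ) :
    IntervalIntegrable (fun s => ∫ ω, h (Z s.toNNReal ω) ∂P) volume a b :=
  (intervalIntegrable_const (c := M)).mono_fun
    (hZ.stronglyMeasurable_integral_comp h).aestronglyMeasurable
    (Eventually.of_forall fun _ => (abs_integral_comp_le h _ (hM _)).trans (le_abs_self M))

/-- Dynkin's formula. -/
theorem integral_comp_eq (hZ : N.IsRealization p P ℱ Z) {h : N.Config → ℝ}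
    (hb : ∃ c, ∀ z, |h z| ≤ c) {M : ℝ} (hM : ∀ t ω, |N.generator h (Z t ω)| ≤ M) (t : ℝ≥0) :
    ∫ ω, h (Z t ω) ∂P = ∫ ω, h (Z 0 ω) ∂P +
      ∫ s in (0 : ℝ)..t, ∫ ω, N.generator h (Z s.toNNReal ω) ∂P := by
  obtain ⟨c, hc⟩ := hb
  have hmart := hZ.martingale h ⟨c, hc⟩
  -- The martingale has the same mean at times `0` and `t`, and its integral term vanishes at `0`.
  -- Fubini then exchanges expectation and time integral.
  have h1 := hmart.condExp_ae_eq (zero_le (a := t))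
  have h2 := (integral_congr_ae h1).symm.trans (integral_condExp (ℱ.le 0))
  have : IsFiniteMeasure (volume.restrict (Set.uIoc (0 : ℝ) t)) := by
    rw [Set.uIoc_of_le t.coe_nonneg]; infer_instance
  have hint : Integrable (Function.uncurry fun (s : ℝ) ω => N.generator h (Z s.toNNReal ω))
      ((volume.restrict (Set.uIoc (0 : ℝ) t)).prod P) :=
    Integrable.of_bound (hZ.measurable_comp_uncurry (N.generator h)).aestronglyMeasurable M
      (Eventually.of_forall fun q => hM _ _)
  rw [intervalIntegral_integral_swap hint]
  simp only [NNReal.coe_zero, intervalIntegral.integral_same, sub_zero] at h2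
  rw [integral_sub (hZ.integrable_comp t fun ω => hc _)] at h2
  · linarith
  · simp_rw [intervalIntegral.intervalIntegral_eq_integral_uIoc]
    exact hint.integral_prod_right.const_mul _

theorem integral_comp_fst_eq_sum (hZ : N.IsRealization p P ℱ Z) (g : N.State → ℝ) (t : ℝ≥0) :
    ∫ ω, g (Z t ω).1 ∂P = ∑ x ∈ N.stateSpace, P.real {ω | (Z t ω).1 = x} * g x := by
  have h1 : ∀ ω, g (Z t ω).1 = ∑ x ∈ N.stateSpace, {ω | (Z t ω).1 = x}.indicator (fun _ => g x) ω := by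
    intro ω
    rw [Finset.sum_eq_single (Z t ω).1]
    · simp
    · intro x _ hx
      simp [Set.indicator, hx.symm]
    · exact fun h => absurd (hZ.mem_stateSpace t ω) h
  have hmeas : ∀ x, MeasurableSet {ω | (Z t ω).1 = x} := fun x =>
    (measurable_fst.comp ((hZ.adapted t).mono (ℱ.le t) le_rfl)) (measurableSet_singleton x)
  simp_rw [h1]
  rw [integral_finsetSum _ fun x _ => (integrable_const _).indicator (hmeas x)]
  refine Finset.sum_congr rfl fun x _ => ?_
  rw [integral_indicator_const _ (hmeas x), smul_eq_mul]

theorem exists_bound_comp_fst (hZ : N.IsRealization p P ℱ Z) (g : N.State → ℝ) :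
    ∃ M, ∀ t ω, |g (Z t ω).1| ≤ M :=
  ⟨∑ x ∈ N.stateSpace, |g x|, fun t ω =>
    Finset.single_le_sum (f := fun x => |g x|) (fun _ _ => abs_nonneg _) (hZ.mem_stateSpace t ω)⟩

/-- The state process is stationary. -/
theorem real_state_eq (hp : N.IsStationary p) (hZ : N.IsRealization p P ℱ Z) (t : ℝ≥0)
    {x : N.State} (hx : x ∈ N.stateSpace) : P.real {ω | (Z t ω).1 = x} = p x := by
  classical
  -- Off the diagonal, the entry at `x`, `y` is the jump rate from `y` to `x`, so that `u' = A u` is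
  -- the forward equation for the state probabilities.
  let A : Matrix N.stateSpace N.stateSpace ℝ := fun x y =>
    N.generator (fun z => (Pi.single x.1 1 : N.State → ℝ) z.1) (y.1, 0, 0)
  let L : (N.stateSpace → ℝ) →L[ℝ] (N.stateSpace → ℝ) :=
    LinearMap.toContinuousLinearMap (Matrix.mulVecLin A)
  let u : ℝ → N.stateSpace → ℝ := fun s x => P.real {ω | (Z s.toNNReal ω).1 = x.1}
  have hL : ∀ v x, L v x = ∑ y, A x y * v y := fun v x => rfl
  have hexp : ∀ (x : N.stateSpace) (s : ℝ≥0),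
      ∫ ω, N.generator (fun z => (Pi.single x.1 1 : N.State → ℝ) z.1) (Z s ω) ∂P =
        L (u s) x := fun x s => by
    simp_rw [N.generator_comp_fst (Pi.single x.1 1) (Z s _)]
    rw [hZ.integral_comp_fst_eq_sum fun y =>
      N.generator (fun z => (Pi.single x.1 1 : N.State → ℝ) z.1) (y, 0, 0), hL,
      ← Finset.sum_coe_sort]
    exact Finset.sum_congr rfl fun y _ => by simp only [u, A, Real.toNNReal_coe]; ring
  have hind : ∀ (x : N.stateSpace) (s : ℝ≥0),
      ∫ ω, (Pi.single x.1 1 : N.State → ℝ) (Z s ω).1 ∂P = u s x := fun x s => by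
    rw [hZ.integral_comp_fst_eq_sum, Finset.sum_eq_single x.1]
    · simp [u]
    · intro y _ hy
      simp [Pi.single_eq_of_ne hy]
    · exact fun h => absurd x.2 h
  have hbd : ∀ x : N.stateSpace, ∃ M, ∀ t ω,
      |N.generator (fun z => (Pi.single x.1 1 : N.State → ℝ) z.1) (Z t ω)| ≤ M := fun x => by
    obtain ⟨M, hM⟩ := hZ.exists_bound_comp_fst fun y =>
      N.generator (fun z => (Pi.single x.1 1 : N.State → ℝ) z.1) (y, 0, 0)
    exact ⟨M, fun t ω => by rw [N.generator_comp_fst (Pi.single x.1 1)]; exact hM t ω⟩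
  have hdyn : ∀ (x : N.stateSpace) (s : ℝ≥0), u s x = u 0 x +
      ∫ r in (0 : ℝ)..s, ∫ ω, N.generator (fun z => (Pi.single x.1 1 : N.State → ℝ) z.1)
        (Z r.toNNReal ω) ∂P := fun x s => by
    obtain ⟨M, hM⟩ := hbd x
    rw [← hind x s, hZ.integral_comp_eq ⟨1, fun z => ?_⟩ hM s, hind x 0]
    · rfl
    · by_cases hz : z.1 = x.1
      · simp [hz]
      · simp [Pi.single_eq_of_ne hz]
  have hu_toNNReal : ∀ s, u s.toNNReal = u s := fun s => by
    simp only [u, Real.toNNReal_coe]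
  -- Continuity comes from the integral formula, with bounded integrand. It is what allows the
  -- integral equation to be differentiated.
  have hcont : Continuous u := by
    refine continuous_pi fun x => ?_
    obtain ⟨M, hM⟩ := hbd x
    have h1 : (fun s => u s x) = fun s : ℝ => u 0 x + ∫ r in (0 : ℝ)..(s.toNNReal : ℝ),
        ∫ ω, N.generator (fun z => (Pi.single x.1 1 : N.State → ℝ) z.1) (Z r.toNNReal ω) ∂P := by
      funext s
      rw [← hu_toNNReal, hdyn]
    rw [h1]
    exact continuous_const.add ((intervalIntegral.continuous_primitive
      (fun a b => hZ.intervalIntegrable_integral_comp hM a b) 0).comp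
      (NNReal.continuous_coe.comp continuous_real_toNNReal))
  have h0 : u 0 = fun x => p x.1 := by
    funext x
    simp only [u, Real.toNNReal_zero, hZ.init_state]
  have hconst : u t = u 0 := by
    refine eq_const_of_integral_eq_linear L hcont (fun s hs => ?_) ?_ t.2
    · funext x
      lift s to ℝ≥0 using hs
      have hLc : Continuous fun r => L (u r) := L.continuous.comp hcont
      rw [hdyn, Pi.add_apply]
      congr 1
      have h2 := (ContinuousLinearMap.proj (R := ℝ) (φ := fun _ : N.stateSpace => ℝ)
        x).intervalIntegral_comp_comm (hLc.intervalIntegrable (μ := volume) 0 s)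
      simp only [ContinuousLinearMap.proj_apply] at h2
      rw [← h2]
      simp_rw [hexp, hu_toNNReal]
    -- Global balance tested on indicators says exactly that `p` lies in the kernel of `A`.
    · funext x
      rw [hL, h0, Pi.zero_apply, ← hp.balance (Pi.single x.1 1), ← Finset.sum_coe_sort N.stateSpace]
      exact Finset.sum_congr rfl fun y _ => mul_comm _ _
  have h3 := congrFun (hconst.trans h0) ⟨x, hx⟩
  simpa only [u, Real.toNNReal_coe] using h3

theorem integral_comp_fst (hp : N.IsStationary p) (hZ : N.IsRealization p P ℱ Z)
    (g : N.State → ℝ) (t : ℝ≥0) : ∫ ω, g (Z t ω).1 ∂P = ∑ x ∈ N.stateSpace, p x * g x := by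
  rw [hZ.integral_comp_fst_eq_sum]
  exact Finset.sum_congr rfl fun x hx => by rw [hZ.real_state_eq hp t hx]

/-- Mean of a counter that starts at zero and has intensity `g` in the stationary regime. -/
theorem integrable_and_integral_counter (hp : N.IsStationary p) (hZ : N.IsRealization p P ℱ Z)
    (c : N.Config → ℕ) (hc0 : ∀ ω, c (Z 0 ω) = 0) (g : N.State → ℝ) {M : ℝ} (hg0 : ∀ x, 0 ≤ g x)
    (hgM : ∀ x, g x ≤ M)
    (hgen : ∀ n : ℕ, ∀ z, N.generator (fun z => min (c z : ℝ) n) z =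
      g z.1 * if c z < n then 1 else 0) (t : ℝ≥0) :
    Integrable (fun ω => (c (Z t ω) : ℝ)) P ∧
      ∫ ω, (c (Z t ω) : ℝ) ∂P = t * ∑ x ∈ N.stateSpace, p x * g x := by
  have hbd : ∀ n : ℕ, ∀ z, |g z.1 * if c z < n then (1 : ℝ) else 0| ≤ M := fun n z => by
    split_ifs
    · rw [mul_one, abs_of_nonneg (hg0 _)]; exact hgM _
    · rw [mul_zero, abs_zero]; exact (hg0 z.1).trans (hgM _)
  have hdyn : ∀ n : ℕ, ∫ ω, min (c (Z t ω) : ℝ) n ∂P =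
      ∫ s in (0 : ℝ)..t, ∫ ω, (g (Z s.toNNReal ω).1 * if c (Z s.toNNReal ω) < n then 1 else 0) ∂P :=
    fun n => by
      have h1 := hZ.integral_comp_eq (h := fun z => min (c z : ℝ) n)
        ⟨n, fun z => by rw [abs_of_nonneg (by positivity)]; exact min_le_right _ _⟩
        (M := M) (fun t ω => by rw [hgen]; exact hbd _ _) t
      simpa [hgen, hc0] using h1
  -- For each path and time the cutoff `c < n` is eventually inactive. As `M` bounds all the
  -- integrands, dominated convergence applies to the expectation and then to the time integral.
  have hlim : Tendsto (fun n : ℕ => ∫ ω, min (c (Z t ω) : ℝ) n ∂P) atTop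
      (𝓝 (t * ∑ x ∈ N.stateSpace, p x * g x)) := by
    have h2 : (t : ℝ) * ∑ x ∈ N.stateSpace, p x * g x =
        ∫ s in (0 : ℝ)..t, ∫ ω, g (Z s.toNNReal ω).1 ∂P := by
      simp_rw [hZ.integral_comp_fst hp]
      simp
    rw [h2]
    simp_rw [hdyn]
    refine intervalIntegral.tendsto_integral_filter_of_dominated_convergence (fun _ => M)
      (Eventually.of_forall fun n => (hZ.stronglyMeasurable_integral_comp
        fun z => g z.1 * if c z < n then 1 else 0).aestronglyMeasurable)
      (Eventually.of_forall fun n => Eventually.of_forall fun s _ =>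
        abs_integral_comp_le (fun z => g z.1 * if c z < n then 1 else 0) _ fun ω => hbd n _)
      intervalIntegrable_const (Eventually.of_forall fun s _ => ?_)
    refine tendsto_integral_of_dominated_convergence (fun _ => M)
      (fun n => (hZ.measurable_comp (fun z => g z.1 * if c z < n then 1 else 0)
        _).aestronglyMeasurable) (integrable_const _)
      (fun n => Eventually.of_forall fun ω => hbd n _) (Eventually.of_forall fun ω => ?_)
    refine tendsto_nhds_of_eventually_eq ((eventually_gt_atTop (c (Z s.toNNReal ω))).mono
      fun n hn => ?_)
    rw [if_pos hn, mul_one]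
  have hmin : ∀ k : ℕ, Tendsto (fun n : ℕ => min (k : ℝ) n) atTop (𝓝 k) := fun k =>
    tendsto_nhds_of_eventually_eq ((eventually_ge_atTop k).mono fun n hn =>
      min_eq_left (by exact_mod_cast hn))
  have hmeas := hZ.measurable_comp (fun z => (c z : ℝ)) t
  have hint_min : ∀ n : ℕ, Integrable (fun ω => min (c (Z t ω) : ℝ) n) P := fun n =>
    hZ.integrable_comp (h := fun z => min (c z : ℝ) n) (M := n) t fun ω => by
      rw [abs_of_nonneg (by positivity)]; exact min_le_right _ _
  -- By monotone convergence the mean of the counter is the limit just found, hence finite. The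
  -- counter itself can then dominate its truncations.
  have hint : Integrable (fun ω => (c (Z t ω) : ℝ)) P := by
    refine ⟨hmeas.aestronglyMeasurable, ?_⟩
    rw [hasFiniteIntegral_iff_ofReal (Eventually.of_forall fun ω => Nat.cast_nonneg _)]
    have h3 : Tendsto (fun n : ℕ => ∫⁻ ω, ENNReal.ofReal (min (c (Z t ω) : ℝ) n) ∂P) atTop
        (𝓝 (∫⁻ ω, ENNReal.ofReal (c (Z t ω)) ∂P)) :=
      lintegral_tendsto_of_tendsto_of_monotone
        (fun n => (hint_min n).aestronglyMeasurable.aemeasurable.ennreal_ofReal)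
        (Eventually.of_forall fun ω m n hmn => ENNReal.ofReal_le_ofReal
          (min_le_min_left _ (by exact_mod_cast hmn)))
        (Eventually.of_forall fun ω => ENNReal.tendsto_ofReal (hmin _))
    have h4 : ∀ n : ℕ, ∫⁻ ω, ENNReal.ofReal (min (c (Z t ω) : ℝ) n) ∂P =
        ENNReal.ofReal (∫ ω, min (c (Z t ω) : ℝ) n ∂P) := fun n =>
      (ofReal_integral_eq_lintegral_ofReal (hint_min n)
        (Eventually.of_forall fun ω => by positivity)).symm
    simp_rw [h4] at h3
    rw [tendsto_nhds_unique h3 (ENNReal.tendsto_ofReal hlim)]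
    exact ENNReal.ofReal_lt_top
  refine ⟨hint, tendsto_nhds_unique ?_ hlim⟩
  refine tendsto_integral_of_dominated_convergence (fun ω => (c (Z t ω) : ℝ))
    (fun n => (hint_min n).aestronglyMeasurable) hint
    (fun n => Eventually.of_forall fun ω => ?_) (Eventually.of_forall fun ω => hmin _)
  rw [Real.norm_of_nonneg (by positivity)]
  exact min_le_left _ _

theorem integrable_and_integral_requests (hp : N.IsStationary p) (hZ : N.IsRealization p P ℱ Z)
    (t : ℝ≥0) (f : F) : Integrable (requests Z f t) P ∧
      ∫ ω, requests Z f t ω ∂P = t * (N.prob p (N.countsWithFreeQubits f) * N.arrivalRate f) := by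
  rw [← sum_mul_requestRate]
  exact hZ.integrable_and_integral_counter hp (fun z => z.2.1 f)
    (fun ω => by rw [hZ.init_counts]; rfl) (fun x => N.requestRate x f)
    (fun x => N.requestRate_nonneg x f) (fun x => N.requestRate_le x f)
    (fun n z => N.generator_min_requests f n z) t

theorem integrable_and_integral_blocked (hp : N.IsStationary p) (hZ : N.IsRealization p P ℱ Z)
    (t : ℝ≥0) (f : F) : Integrable (blocked Z f t) P ∧
      ∫ ω, blocked Z f t ω ∂P =
        t * (N.prob p (N.countsWithTotal N.resources ∩ N.countsWithFreeQubits f) *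
          N.arrivalRate f) := by
  rw [← sum_mul_blockedRate]
  exact hZ.integrable_and_integral_counter hp (fun z => z.2.2 f)
    (fun ω => by rw [hZ.init_counts]; rfl) (fun x => N.blockedRate x f)
    (fun x => N.blockedRate_nonneg x f) (fun x => N.blockedRate_le x f)
    (fun n z => N.generator_min_blocked f n z) t

end IsRealization

end EGS

/-! ### Blocking probabilities -/

theorem corollary1 {F : Type*} [Fintype F] [DecidableEq F] {K : ℕ} (N : EGS F K)
    (p : N.State → ℝ) (hp : N.IsStationary p)
    {Ω : Type*} {mΩ : MeasurableSpace Ω} (P : Measure Ω) [IsProbabilityMeasure P]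
    (ℱ : Filtration ℝ≥0 mΩ) (Z : ℝ≥0 → Ω → N.Config) (hZ : N.IsRealization p P ℱ Z)
    (t : ℝ≥0) (ht : 0 < t) :
    -- the expected numbers of requests are finite, and requests do arrive
    (∀ f, Integrable (EGS.requests Z f t) P ∧ Integrable (EGS.blocked Z f t) P) ∧
    (0 < ∫ ω, ∑ f, EGS.requests Z f t ω ∂P) ∧
    (∀ f, 0 < N.arrivalRate f → 0 < ∫ ω, EGS.requests Z f t ω ∂P) ∧
    -- the weights are well defined
    (∀ f, 0 < N.prob p (N.countsWithFreeQubits f)) ∧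
    (0 < ∑ g, N.prob p (N.countsWithFreeQubits g) * N.arrivalRate g) ∧
    -- the per-flow blocking probabilities are the conditional probabilities of seeing all
    -- resources occupied, given that both nodes have a free qubit
    (∀ f, 0 < N.arrivalRate f →
      EGS.flowBlockingProb P Z t f =
        N.prob p (N.countsWithTotal N.resources ∩ N.countsWithFreeQubits f) /
          N.prob p (N.countsWithFreeQubits f)) ∧
    -- the average blocking probability
    EGS.avgBlockingProb P Z t =
      ∑ f, (N.prob p (N.countsWithFreeQubits f) * N.arrivalRate f /
          ∑ g, N.prob p (N.countsWithFreeQubits g) * N.arrivalRate g) *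
        EGS.flowBlockingProb P Z t f := by
  have hreq := fun f => hZ.integrable_and_integral_requests hp t f
  have hblk := fun f => hZ.integrable_and_integral_blocked hp t f
  have hpos := fun f => hp.prob_countsWithFreeQubits_pos f
  have ht' : (0 : ℝ) < t := ht
  have hsum : 0 < ∑ g, N.prob p (N.countsWithFreeQubits g) * N.arrivalRate g := by
    obtain ⟨f, hf⟩ := N.exists_arrivalRate_pos
    exact Finset.sum_pos' (fun g _ => mul_nonneg (hpos g).le (N.arrivalRate_nonneg g))
      ⟨f, Finset.mem_univ f, mul_pos (hpos f) hf⟩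
  have hsumreq : ∫ ω, ∑ f, EGS.requests Z f t ω ∂P =
      t * ∑ g, N.prob p (N.countsWithFreeQubits g) * N.arrivalRate g := by
    rw [integral_finsetSum _ fun f _ => (hreq f).1, Finset.mul_sum]
    exact Finset.sum_congr rfl fun f _ => (hreq f).2
  have hsumblk : ∫ ω, ∑ f, EGS.blocked Z f t ω ∂P =
      t * ∑ f, N.prob p (N.countsWithTotal N.resources ∩ N.countsWithFreeQubits f) *
        N.arrivalRate f := by
    rw [integral_finsetSum _ fun f _ => (hblk f).1, Finset.mul_sum]
    exact Finset.sum_congr rfl fun f _ => (hblk f).2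
  have hflow : ∀ f, 0 < N.arrivalRate f → EGS.flowBlockingProb P Z t f =
      N.prob p (N.countsWithTotal N.resources ∩ N.countsWithFreeQubits f) /
        N.prob p (N.countsWithFreeQubits f) := fun f hf => by
    rw [EGS.flowBlockingProb, (hreq f).2, (hblk f).2, mul_div_mul_left _ _ ht'.ne',
      mul_div_mul_right _ _ hf.ne']
  refine ⟨fun f => ⟨(hreq f).1, (hblk f).1⟩, ?_, fun f hf => ?_, hpos, hsum, hflow, ?_⟩
  · rw [hsumreq]; exact mul_pos ht' hsum
  · rw [(hreq f).2]; exact mul_pos ht' (mul_pos (hpos f) hf)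
  · rw [EGS.avgBlockingProb, hsumreq, hsumblk, mul_div_mul_left _ _ ht'.ne', Finset.sum_div]
    refine Finset.sum_congr rfl fun f _ => ?_
    -- A flow without requests has weight zero and no mean number of blocked requests, so it
    -- contributes nothing to either side.
    rcases (N.arrivalRate_nonneg f).eq_or_lt with h0 | hf
    · simp [← h0]
    · rw [hflow f hf, div_mul_div_comm, div_eq_div_iff hsum.ne' (mul_pos hsum (hpos f)).ne']
      ring
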